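/- Let $G$ be a Lie groupoid with source and target maps $s,t$ over a manifold $M$ (all manifolds finite-dimensional, smooth, Hausdorff and second countable; $gh$ is defined when $s(g)=t(h)$). Let $x\in M$, let $\mathcal O=\mathcal O_x=\{t(g): s(g)=x\}$ be its orbit, an immersed submanifold of $M$, and let $G_x=s^{-1}(x)\cap t^{-1}(x)$ be its isotropy group. Let $G_{\mathcal O}$ be the set of arrows $g$ with $s(g),t(g)\in\mathcal O$, let $\mathcal N_{\mathcal O}=TM|_{\mathcal O}/T\mathcal O$ be the normal bundle, on which $G_{\mathcal O}$ acts linearly by $g\cdot[ds(\xi)]=[dt(\xi)]$ for $\xi\in T_gG$, and let the linearization $\mathcal N_{\mathcal O}(G)=\{(g,v)\in G_{\mathcal O}\times\mathcal N_{\mathcal O}: v\text{ lies over }s(g)\}$ be the Lie groupoid over $\mathcal N_{\mathcal O}$ with source $(g,v)\mapsto v$, target $(g,v)\mapsto g\cdot v$ and product $(g,v)(h,w)=(gh,w)$. Suppose that $G$ is linearizable at $\mathcal O$: there are open neighborhoods $U\subset M$ of $\mathcal O$ and $V\subset\mathcal N_{\mathcal O}$ of the zero section $\mathcal O$, and an isomorphism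 of Lie groupoids $G|_U\cong\mathcal N_{\mathcal O}(G)|_V$ which is the identity on $G_{\mathcal O}$. Call $G$ proper at $x$ if every sequence $(g_n)$ of arrows with $(s(g_n),t(g_n))\to(x,x)$ has a convergent subsequence, and $s$-proper at $x$ if every sequence $(g_n)$ of arrows with $s(g_n)\to x$ has a convergent subsequence. Call $\mathcal O$ stable if every open neighborhood of $\mathcal O$ contains an open neighborhood of $\mathcal O$ that is a union of orbits. Then: (a) $G$ is proper at $x$ if and only if $G_x$ is compact. (b) If $G$ is $s$-proper at $x$, then $G_x$ is compact and $\mathcal O$ is stable. Conversely, if $G_x$ is compact and $\mathcal O$ is stable, and if moreover $\mathcal O$ is not open in $M$ (that is, $\mathcal N_{\mathcal O}\neq 0$) or $\mathcal O$ is compact, then $G$ is $s$-proper at $x$. -/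

import Mathlib

open scoped Manifold ContDiff Topology

/-- A Lie groupoid with manifold of objects `M` (modelled on `E`) and manifold of arrows `A`
(modelled on `F`). The multiplication `mul g h` is meaningful only for composable arrows, that is,
for `src g = tgt h`; its values on other pairs are irrelevant, and no law mentions them.
Since `src` and `tgt` are submersions, the set of composable pairs is an embedded submanifold of
`A × A`; on an embedded submanifold `S`, `ContMDiffOn … S` is smoothness of the restriction. -/
structure LieGroupoid (E F M A : Type*)
    [NormedAddCommGroup E] [NormedSpace ℝ E] [NormedAddCommGroup F] [NormedSpace ℝ F]
    [TopologicalSpace M] [ChartedSpace E M] [TopologicalSpace A] [ChartedSpace F A] where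
  src : A → M
  tgt : A → M
  unit : M → A
  inv : A → A
  mul : A → A → A
  src_submersion : Manifold.IsSubmersion 𝓘(ℝ, F) 𝓘(ℝ, E) ∞ src
  tgt_submersion : Manifold.IsSubmersion 𝓘(ℝ, F) 𝓘(ℝ, E) ∞ tgt
  unit_smooth : ContMDiff 𝓘(ℝ, E) 𝓘(ℝ, F) ∞ unit
  inv_smooth : ContMDiff 𝓘(ℝ, F) 𝓘(ℝ, F) ∞ inv
  mul_smooth : ContMDiffOn (𝓘(ℝ, F).prod 𝓘(ℝ, F)) 𝓘(ℝ, F) ∞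
    (fun p : A × A => mul p.1 p.2) {p : A × A | src p.1 = tgt p.2}
  src_unit : ∀ y, src (unit y) = y
  tgt_unit : ∀ y, tgt (unit y) = y
  src_inv : ∀ g, src (inv g) = tgt g
  tgt_inv : ∀ g, tgt (inv g) = src g
  src_mul : ∀ g h, src g = tgt h → src (mul g h) = src h
  tgt_mul : ∀ g h, src g = tgt h → tgt (mul g h) = tgt g
  mul_assoc : ∀ g h k, src g = tgt h → src h = tgt k → mul (mul g h) k = mul g (mul h k)
  unit_mul : ∀ g, mul (unit (tgt g)) g = g
  mul_unit : ∀ g, mul g (unit (src g)) = g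
  inv_mul : ∀ g, mul (inv g) g = unit (src g)
  mul_inv : ∀ g, mul g (inv g) = unit (tgt g)

/-- Let `Z` be a set carrying, along the surjection `q : S → q(S) ⊆ Z` from an embedded
submanifold `S` of `X`, the quotient manifold structure, i.e. the unique one for which `q` is a
submersion. A partial bijection `φ` from `q(S)` to an open part of the manifold `Y` is a
diffeomorphism iff `φ ∘ q` is smooth and `φ⁻¹` lifts locally to smooth maps into `S`. -/
structure IsDiffeoOfQuotient {E₁ H₁ X E₂ H₂ Y Z : Type*}
    [NormedAddCommGroup E₁] [NormedSpace ℝ E₁] [TopologicalSpace H₁]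
    (I : ModelWithCorners ℝ E₁ H₁) [TopologicalSpace X] [ChartedSpace H₁ X]
    [NormedAddCommGroup E₂] [NormedSpace ℝ E₂] [TopologicalSpace H₂]
    (J : ModelWithCorners ℝ E₂ H₂) [TopologicalSpace Y] [ChartedSpace H₂ Y]
    (S : Set X) (q : X → Z) (φ : PartialEquiv Z Y) : Prop where
  source_subset : φ.source ⊆ q '' S
  smooth : ContMDiffOn I J ∞ (fun a => φ (q a)) (S ∩ q ⁻¹' φ.source)
  smooth_symm : ∀ y ∈ φ.target, ∃ W : Set Y, IsOpen W ∧ y ∈ W ∧ W ⊆ φ.target ∧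
    ∃ σ : Y → X, ContMDiffOn J I ∞ σ W ∧ ∀ z ∈ W, σ z ∈ S ∧ q (σ z) = φ.symm z

namespace LieGroupoid

noncomputable section

variable {E F M A : Type*}
  [NormedAddCommGroup E] [NormedSpace ℝ E] [NormedAddCommGroup F] [NormedSpace ℝ F]
  [TopologicalSpace M] [ChartedSpace E M] [TopologicalSpace A] [ChartedSpace F A]
  (G : LieGroupoid E F M A)

/-- The orbit through `x`. -/
def orbit (x : M) : Set M := {y | ∃ g, G.src g = x ∧ G.tgt g = y}

/-- The isotropy group at `x`; its topology is the one induced from the manifold of arrows. -/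
def isotropy (x : M) : Set A := {g | G.src g = x ∧ G.tgt g = x}

/-- The set `U` contains every orbit that it meets. -/
def IsInvariant (U : Set M) : Prop := ∀ y ∈ U, G.orbit y ⊆ U

/-- The orbit through `x` admits arbitrarily small invariant (open) neighborhoods. -/
def IsStableOrbit (x : M) : Prop :=
  ∀ W : Set M, IsOpen W → G.orbit x ⊆ W →
    ∃ U : Set M, IsOpen U ∧ G.orbit x ⊆ U ∧ G.IsInvariant U ∧ U ⊆ W

/-- Properness at `x`. -/
def IsProperAt (x : M) : Prop :=
  ∀ g : ℕ → A,
    Filter.Tendsto (fun n => (G.src (g n), G.tgt (g n))) Filter.atTop (𝓝 (x, x)) →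
    ∃ (a : A) (k : ℕ → ℕ), StrictMono k ∧ Filter.Tendsto (fun n => g (k n)) Filter.atTop (𝓝 a)

/-- `s`-properness at `x`. -/
def IsSProperAt (x : M) : Prop :=
  ∀ g : ℕ → A, Filter.Tendsto (fun n => G.src (g n)) Filter.atTop (𝓝 x) →
    ∃ (a : A) (k : ℕ → ℕ), StrictMono k ∧ Filter.Tendsto (fun n => g (k n)) Filter.atTop (𝓝 a)

/-- The differential of the source map at the arrow `g`. -/
def dsrc (g : A) : TangentSpace 𝓘(ℝ, F) g →L[ℝ] TangentSpace 𝓘(ℝ, E) (G.src g) :=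
  mfderiv 𝓘(ℝ, F) 𝓘(ℝ, E) G.src g

/-- The differential of the target map at the arrow `g`. -/
def dtgt (g : A) : TangentSpace 𝓘(ℝ, F) g →L[ℝ] TangentSpace 𝓘(ℝ, E) (G.tgt g) :=
  mfderiv 𝓘(ℝ, F) 𝓘(ℝ, E) G.tgt g

/-- The tangent space at `y` to the orbit through `y`: the image under the differential of the
target map of the tangent space, at the unit of `y`, to the source fiber. (The tangent space at
`tgt (unit y) = y` is read as the tangent space at `y`.) -/
def orbitTangent (y : M) : Submodule ℝ (TangentSpace 𝓘(ℝ, E) y) :=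
  G.tgt_unit y ▸ Submodule.map (G.dtgt (G.unit y)).toLinearMap
    (LinearMap.ker (G.dsrc (G.unit y)).toLinearMap)

/-- A vector normal to an orbit: a point `y` with an element of `T_y M / T_y 𝒪_y`. -/
abbrev NormalVector : Type _ := Σ y : M, TangentSpace 𝓘(ℝ, E) y ⧸ G.orbitTangent y

/-- The normal vector at `y` represented by the tangent vector `w`. -/
def normalClass (y : M) (w : TangentSpace 𝓘(ℝ, E) y) : G.NormalVector :=
  ⟨y, Submodule.Quotient.mk w⟩

/-- The normal bundle `TM|_𝒪 / T𝒪` of the orbit `𝒪` through `x`, as a set. -/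
def normalBundle (x : M) : Set G.NormalVector := {v | v.1 ∈ G.orbit x}

/-- The action of an arrow `g : y ⟶ z` on a normal vector `v` at `y`: if the tangent vector `ξ`
at `g` is such that `ds ξ` represents `v`, then `g · v` is represented by `dt ξ`. Such a `ξ` exists
because the source map is a submersion, and `g · v` does not depend on its choice. (If `v` does not
sit over the source of `g`, then the value is irrelevant.) -/
def normalAct (g : A) (v : G.NormalVector) : G.NormalVector :=
  G.normalClass (G.tgt g) (G.dtgt g
    (Classical.epsilon fun ξ : TangentSpace 𝓘(ℝ, F) g => G.normalClass (G.src g) (G.dsrc g ξ) = v))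

variable [IsManifold 𝓘(ℝ, E) ∞ M]

/-- The submanifold `t^*TM = {(p, w) | p ∈ s⁻¹(x), w ∈ T_{t(p)} M}` of `A × TM`. It submerses onto
`TM|_𝒪` (`𝒪` with its immersed structure, the quotient of `s⁻¹(x)` along the target map). -/
def baseFrame (x : M) : Set (A × TangentBundle 𝓘(ℝ, E) M) :=
  {a | G.src a.1 = x ∧ G.tgt a.1 = a.2.proj}

/-- The map `(p, w) ↦ [w]` of `t^*TM` onto the normal bundle. -/
def baseQuot (a : A × TangentBundle 𝓘(ℝ, E) M) : G.NormalVector :=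
  G.normalClass a.2.proj a.2.snd

/-- The submanifold `s⁻¹(x) × t^*TM` of `A × (A × TM)`. -/
def arrowFrame (x : M) : Set (A × (A × TangentBundle 𝓘(ℝ, E) M)) :=
  {a | G.src a.1 = x ∧ a.2 ∈ G.baseFrame x}

/-- The map `(p, q, w) ↦ (p q⁻¹, [w])` of `s⁻¹(x) × t^*TM` onto the space of arrows
`{(g, v) | g ∈ G_𝒪, v ∈ N_𝒪, s(g) = π(v)}` of the linearization. It combines the quotient map
`(p, q) ↦ p q⁻¹` of `s⁻¹(x) × s⁻¹(x)` onto `G_𝒪` with the one onto the normal bundle. -/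
def arrowQuot (a : A × (A × TangentBundle 𝓘(ℝ, E) M)) : A × G.NormalVector :=
  (G.mul a.1 (G.inv a.2.1), G.baseQuot a.2)

/-- `V` is an open subset of the normal bundle of the orbit through `x`. -/
def IsOpenInNormalBundle (x : M) (V : Set G.NormalVector) : Prop :=
  V ⊆ G.normalBundle x ∧ ∃ W : Set (A × TangentBundle 𝓘(ℝ, E) M), IsOpen W ∧
    G.baseFrame x ∩ G.baseQuot ⁻¹' V = G.baseFrame x ∩ W

/-- The arrows `(g, v)` of the linearization, with `s(g) = π(v)`. -/
def linArrows (x : M) : Set (A × G.NormalVector) :=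
  {a | G.src a.1 = a.2.1 ∧ a.2 ∈ G.normalBundle x}

/-- The source map `(g, v) ↦ v` of the linearization. -/
def linSrc (a : A × G.NormalVector) : G.NormalVector := a.2

/-- The target map `(g, v) ↦ g · v` of the linearization. -/
def linTgt (a : A × G.NormalVector) : G.NormalVector := G.normalAct a.1 a.2

/-- The multiplication `(g, v) (h, w) = (g h, w)` of the linearization. -/
def linMul (a b : A × G.NormalVector) : A × G.NormalVector := (G.mul a.1 b.1, b.2)

/-- `G` is linearizable at the orbit `𝒪` through `x`: there are open neighborhoods `U` of `𝒪` in
`M` and `V` of (the zero section) `𝒪` in its normal bundle, and an isomorphism of Lie groupoids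
`(ψ, φ)` from the restriction to `V` of the linearization to the restriction of `G` to `U`, which
is the identity on `G_𝒪`. -/
def IsLinearizableAt (x : M) : Prop :=
  ∃ (U : Set M) (V : Set G.NormalVector)
    (φ : PartialEquiv G.NormalVector M) (ψ : PartialEquiv (A × G.NormalVector) A),
    IsOpen U ∧ G.orbit x ⊆ U ∧
    G.IsOpenInNormalBundle x V ∧ (∀ y ∈ G.orbit x, G.normalClass y 0 ∈ V) ∧
    φ.source = V ∧ φ.target = U ∧
    ψ.source = {a | a ∈ G.linArrows x ∧ G.linSrc a ∈ V ∧ G.linTgt a ∈ V} ∧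
    ψ.target = {g | G.src g ∈ U ∧ G.tgt g ∈ U} ∧
    IsDiffeoOfQuotient (𝓘(ℝ, F).prod 𝓘(ℝ, E).tangent) 𝓘(ℝ, E) (G.baseFrame x) G.baseQuot φ ∧
    IsDiffeoOfQuotient (𝓘(ℝ, F).prod (𝓘(ℝ, F).prod 𝓘(ℝ, E).tangent)) 𝓘(ℝ, F)
      (G.arrowFrame x) G.arrowQuot ψ ∧
    (∀ a ∈ ψ.source, G.src (ψ a) = φ (G.linSrc a)) ∧
    (∀ a ∈ ψ.source, G.tgt (ψ a) = φ (G.linTgt a)) ∧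
    (∀ a ∈ ψ.source, ∀ b ∈ ψ.source, G.linSrc a = G.linTgt b →
      ψ (G.linMul a b) = G.mul (ψ a) (ψ b)) ∧
    (∀ y ∈ G.orbit x, φ (G.normalClass y 0) = y) ∧
    (∀ g, G.src g ∈ G.orbit x → ψ (g, G.normalClass (G.src g) 0) = g)

end

end LieGroupoid

open Filter Set

/-! The core is `IsLinearizableAt.exists_tendsto_subseq`. The linearization turns arrows `x_n →
y_n`, with `x_n → x` and `y_n → y ∈ 𝒪`, into pairs `(h_n, v_n)`. Local lifts give arrows `q_n`,
`p_n` from `x` to the base points of source and target. Then `p_n⁻¹ h_n q_n` lies in the compact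
isotropy group; a convergent subsequence there yields one of the arrows. Taking `y = x` gives (a).

For `s`-properness only the sources converge. By `IsStableOrbit.exists_mapClusterPt`, stability
makes the targets accumulate in `𝒪` when the arrows lie off `𝒪`. It says nothing about arrows inside
`𝒪`: these are perturbed off `𝒪` if `𝒪` is not open, and otherwise compactness of `𝒪` is used. The
pair groupoid of a noncompact manifold shows that some such condition is needed. -/

/-! ### Submersions and cluster points -/

/-- A submersion between manifolds without boundary is an open map. -/
theorem Manifold.IsSubmersion.isOpenMap {E F M A : Type*}
    [NormedAddCommGroup E] [NormedSpace ℝ E] [NormedAddCommGroup F] [NormedSpace ℝ F]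
    [TopologicalSpace M] [ChartedSpace E M] [TopologicalSpace A] [ChartedSpace F A]
    {f : A → M} (hf : Manifold.IsSubmersion 𝓘(ℝ, F) 𝓘(ℝ, E) ∞ f) : IsOpenMap f := by
  obtain ⟨K, _, _, hf⟩ := hf
  refine isOpenMap_iff_nhds_le.2 fun a => ?_
  have h := hf a
  have ha := h.mem_domChart_source
  have hfa := h.mem_codChart_source
  have hw : ∀ b ∈ h.domChart.source, h.codChart (f b) = (h.equiv (h.domChart b)).1 := by
    intro b hb
    have hb' : h.domChart b ∈ (h.domChart.extend 𝓘(ℝ, F)).target := by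
      simpa using h.domChart.map_source hb
    simpa [hb] using h.writtenInCharts hb'
  -- In the charts `f` is a linear homeomorphism followed by a projection; both push neighborhood
  -- filters onto neighborhood filters.
  have hmap : map (fun b => h.codChart (f b)) (𝓝 a) = 𝓝 (h.codChart (f a)) := by
    rw [map_congr (eventually_of_mem (h.domChart.open_source.mem_nhds ha) hw), hw a ha,
      show (fun b => (h.equiv (h.domChart b)).1) = Prod.fst ∘ h.equiv ∘ h.domChart from rfl,
      ← map_map, ← map_map, h.domChart.map_nhds_eq ha,
      show map h.equiv _ = _ from h.equiv.toHomeomorph.map_nhds_eq _]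
    exact map_fst_nhds _
  have hsymm : map h.codChart.symm (𝓝 (h.codChart (f a))) = 𝓝 (f a) := by
    rw [h.codChart.symm.map_nhds_eq (h.codChart.map_source hfa), h.codChart.left_inv hfa]
  rw [← hsymm, ← hmap, map_map]
  refine (map_congr (eventually_of_mem (h.domChart.open_source.mem_nhds ha) fun b hb => ?_)).le
  exact h.codChart.left_inv (h.source_subset_preimage_source hb)

/-- A sequence avoiding a set and without cluster points in it avoids a neighborhood of the set. -/
theorem notMem_closure_range_of_not_mapClusterPt {X : Type*} [TopologicalSpace X] [T1Space X]
    {u : ℕ → X} {y : X} (hy : ∀ n, u n ≠ y) (hc : ¬ MapClusterPt y atTop u) :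
    y ∉ closure (range u) := by
  rw [mapClusterPt_iff_frequently] at hc
  push Not at hc
  obtain ⟨s, hs, hsu⟩ := hc
  obtain ⟨N, hN⟩ := eventually_atTop.1 hsu
  -- The finitely many terms before `N` are closed and differ from `y`, so they can be removed.
  have hfin : (u '' Iio N)ᶜ ∈ 𝓝 y :=
    ((finite_Iio N).image u).isClosed.isOpen_compl.mem_nhds (by simpa using fun n _ => hy n)
  intro hcl
  obtain ⟨z, ⟨hz, hz'⟩, n, rfl⟩ := mem_closure_iff_nhds.1 hcl _ (inter_mem hs hfin)
  by_cases hn : n < N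
  · exact hz' ⟨n, hn, rfl⟩
  · exact hN n (not_lt.1 hn) hz

/-! ### Orbits and saturations -/

namespace LieGroupoid

variable {E F M A : Type*}
  [NormedAddCommGroup E] [NormedSpace ℝ E] [NormedAddCommGroup F] [NormedSpace ℝ F]
  [TopologicalSpace M] [ChartedSpace E M] [TopologicalSpace A] [ChartedSpace F A]
  (G : LieGroupoid E F M A)

theorem mem_orbit_self (x : M) : x ∈ G.orbit x := ⟨G.unit x, G.src_unit x, G.tgt_unit x⟩

theorem tgt_mem_orbit (g : A) : G.tgt g ∈ G.orbit (G.src g) := ⟨g, rfl, rfl⟩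

theorem tgt_mem_orbit_of_src_mem {x : M} {g : A} (h : G.src g ∈ G.orbit x) :
    G.tgt g ∈ G.orbit x := by
  obtain ⟨p, hp, hpg⟩ := h
  exact ⟨G.mul g p, (G.src_mul g p hpg.symm).trans hp, G.tgt_mul g p hpg.symm⟩

theorem src_mem_orbit_of_tgt_mem {x : M} {g : A} (h : G.tgt g ∈ G.orbit x) :
    G.src g ∈ G.orbit x := by
  have := G.tgt_mem_orbit_of_src_mem (x := x) (g := G.inv g) (by rwa [G.src_inv])
  rwa [G.tgt_inv] at this

theorem continuous_tgt : Continuous G.tgt := G.tgt_submersion.contMDiff.continuous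

theorem continuous_src : Continuous G.src := G.src_submersion.contMDiff.continuous

theorem tendsto_mul {l : Filter ℕ} {g h : ℕ → A} {a b : A} (hg : Tendsto g l (𝓝 a))
    (hh : Tendsto h l (𝓝 b)) (hc : ∀ n, G.src (g n) = G.tgt (h n)) (hab : G.src a = G.tgt b) :
    Tendsto (fun n => G.mul (g n) (h n)) l (𝓝 (G.mul a b)) := by
  have h1 : Tendsto (fun n => (g n, h n)) l (𝓝[{p : A × A | G.src p.1 = G.tgt p.2}] (a, b)) :=
    tendsto_nhdsWithin_iff.2 ⟨hg.prodMk_nhds hh, Eventually.of_forall hc⟩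
  exact (G.mul_smooth.continuousOn (a, b) hab).tendsto.comp h1

/-- The union of the orbits that meet an open set is open. -/
theorem isOpen_saturation {B : Set M} (hB : IsOpen B) : IsOpen (G.tgt '' (G.src ⁻¹' B)) :=
  G.tgt_submersion.isOpenMap _ (hB.preimage G.continuous_src)

theorem isInvariant_saturation (B : Set M) : G.IsInvariant (G.tgt '' (G.src ⁻¹' B)) := by
  rintro _ ⟨g, hg, rfl⟩ z ⟨h, hh, rfl⟩
  exact ⟨G.mul h g, by rwa [mem_preimage, G.src_mul h g hh], G.tgt_mul h g hh⟩

theorem subset_saturation (B : Set M) : B ⊆ G.tgt '' (G.src ⁻¹' B) := fun y hy =>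
  ⟨G.unit y, by rwa [mem_preimage, G.src_unit], G.tgt_unit y⟩

/-- An orbit that is not open has empty interior. -/
theorem interior_orbit_eq_empty {x : M} (h : ¬ IsOpen (G.orbit x)) :
    interior (G.orbit x) = ∅ := by
  by_contra hne
  obtain ⟨y, hy⟩ := nonempty_iff_ne_empty.2 hne
  refine h ?_
  -- Arrows carry one interior point to every point of the orbit, so the orbit is the saturation of
  -- its interior.
  convert G.isOpen_saturation (isOpen_interior (s := G.orbit x)) using 1
  refine Subset.antisymm ?_ ?_
  · rintro _ ⟨g, hg, rfl⟩
    obtain ⟨p, hp, rfl⟩ := interior_subset hy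
    have hc : G.src g = G.tgt (G.inv p) := by rw [hg, G.tgt_inv, hp]
    exact ⟨G.mul g (G.inv p), by rwa [mem_preimage, G.src_mul _ _ hc, G.src_inv],
      G.tgt_mul _ _ hc⟩
  · rintro _ ⟨g, hg, rfl⟩
    exact G.tgt_mem_orbit_of_src_mem (interior_subset hg)

/-! ### Properness, isotropy and stability -/

theorem IsSProperAt.isProperAt {G : LieGroupoid E F M A} {x : M} (h : G.IsSProperAt x) :
    G.IsProperAt x := fun g hg => h g ((continuous_fst.tendsto (x, x)).comp hg)

theorem IsProperAt.isCompact_isotropy [T2Space M] [TopologicalSpace.MetrizableSpace A]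
    {G : LieGroupoid E F M A} {x : M} (h : G.IsProperAt x) : IsCompact (G.isotropy x) := by
  let _ := TopologicalSpace.metrizableSpaceMetric A
  refine IsSeqCompact.isCompact fun g hg => ?_
  obtain ⟨a, k, hk, ha⟩ := h g (by
    simp only [fun n => (hg n).1, fun n => (hg n).2]
    exact tendsto_const_nhds)
  have hcl : IsClosed (G.isotropy x) :=
    (isClosed_singleton.preimage G.continuous_src).inter
      (isClosed_singleton.preimage G.continuous_tgt)
  exact ⟨a, hcl.mem_of_tendsto ha (Eventually.of_forall fun n => hg _), k, hk, ha⟩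

/-- The saturation of a small neighborhood of `x` stays in `W`: otherwise arrows leaving `W`, with
sources tending to `x`, would subconverge to an arrow from `x`, whose target lies in `𝒪 ⊆ W`. -/
theorem IsSProperAt.isStableOrbit [T2Space M] [FirstCountableTopology M]
    {G : LieGroupoid E F M A} {x : M} (h : G.IsSProperAt x) : G.IsStableOrbit x := by
  intro W hW hOW
  obtain ⟨b, hb⟩ := (𝓝 x).exists_antitone_basis
  have key : ∃ n, ∀ g, G.src g ∈ b n → G.tgt g ∈ W := by
    by_contra hcon
    push Not at hcon
    choose g hgb hgW using hcon
    have hgx : Tendsto (fun n => G.src (g n)) atTop (𝓝 x) := hb.tendsto hgb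
    obtain ⟨a, k, hk, ha⟩ := h g hgx
    have hax : G.src a = x :=
      tendsto_nhds_unique ((G.continuous_src.tendsto a).comp ha) (hgx.comp hk.tendsto_atTop)
    have haW : G.tgt a ∈ W := hOW ⟨a, hax, rfl⟩
    obtain ⟨n, hn⟩ := (((G.continuous_tgt.tendsto a).comp ha).eventually
      (hW.mem_nhds haW)).exists
    exact hgW _ hn
  obtain ⟨n, hn⟩ := key
  obtain ⟨B, hBb, hB, hxB⟩ := mem_nhds_iff.1 (hb.toHasBasis.mem_of_mem (i := n) trivial)
  refine ⟨_, G.isOpen_saturation hB, ?_, G.isInvariant_saturation B, ?_⟩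
  · exact G.isInvariant_saturation B x (G.subset_saturation B hxB)
  · rintro _ ⟨g, hg, rfl⟩
    exact hn g (hBb hg)

/-- If the orbit of `x` is stable, then the targets of a sequence of arrows outside of the orbit
whose sources converge to `x` accumulate at a point of the orbit. -/
theorem IsStableOrbit.exists_mapClusterPt [T1Space M]
    {G : LieGroupoid E F M A} {x : M} (h : G.IsStableOrbit x) {g : ℕ → A}
    (hg : Tendsto (fun n => G.src (g n)) atTop (𝓝 x)) (hgO : ∀ n, G.src (g n) ∉ G.orbit x) :
    ∃ y ∈ G.orbit x, MapClusterPt y atTop (fun n => G.tgt (g n)) := by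
  by_contra hcon
  push Not at hcon
  -- Stability is tested on the complement of the closure of the targets: an invariant `U` inside it
  -- would contain some source, hence the target of that arrow.
  obtain ⟨U, hU, hOU, hinv, hUW⟩ := h (closure (range fun n => G.tgt (g n)))ᶜ
    isClosed_closure.isOpen_compl fun y hy =>
      notMem_closure_range_of_not_mapClusterPt
        (fun n hn => hgO n (G.src_mem_orbit_of_tgt_mem (by rwa [hn]))) (hcon y hy)
  obtain ⟨n, hn⟩ := (hg.eventually (hU.mem_nhds (hOU (G.mem_orbit_self x)))).exists
  exact hUW (hinv _ hn (G.tgt_mem_orbit (g n))) (subset_closure (mem_range_self n))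

theorem mul_mul_inv_cancel {g h : A} (hc : G.src g = G.tgt h) :
    G.mul (G.mul g h) (G.inv h) = g := by
  rw [G.mul_assoc _ _ _ hc (G.tgt_inv h).symm, G.mul_inv, ← hc, G.mul_unit]

theorem mul_inv_mul_cancel {g h : A} (hc : G.tgt g = G.tgt h) :
    G.mul g (G.mul (G.inv g) h) = h := by
  rw [← G.mul_assoc _ _ _ (G.tgt_inv g).symm (by rw [G.src_inv, hc]), G.mul_inv, hc, G.unit_mul]

/-! ### Convergence of arrows in the linearizable case -/

section Linearizable

variable [IsManifold 𝓘(ℝ, E) ∞ M]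

/-- If `G` is linearizable at the orbit of `x` and has compact isotropy there, then a sequence of
arrows whose sources converge to `x` and whose targets converge in the orbit has a convergent
subsequence. -/
theorem IsLinearizableAt.exists_tendsto_subseq [T2Space M] [FirstCountableTopology A]
    {G : LieGroupoid E F M A} {x : M} (hG : G.IsLinearizableAt x)
    (hK : IsCompact (G.isotropy x)) {y : M} (hy : y ∈ G.orbit x) {g : ℕ → A}
    (hs : Tendsto (fun n => G.src (g n)) atTop (𝓝 x))
    (ht : Tendsto (fun n => G.tgt (g n)) atTop (𝓝 y)) :
    ∃ (a : A) (k : ℕ → ℕ), StrictMono k ∧ Tendsto (fun n => g (k n)) atTop (𝓝 a) := by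
  obtain ⟨U, V, φ, ψ, hU, hOU, hV, hV0, hφs, hφt, hψs, hψt, hφ, hψ, hsrc, htgt, -, hφ0, hψ0⟩ := hG
  have hφsymm0 : ∀ z ∈ G.orbit x, φ.symm z = G.normalClass z 0 := fun z hz => by
    conv_lhs => rw [← hφ0 z hz]
    exact φ.left_inv (hφs ▸ hV0 z hz)
  have hxO := G.mem_orbit_self x
  -- The lifts go through `s⁻¹(x)`, so base points are followed in the immersed topology of the
  -- orbit, not the one induced from `M`.
  obtain ⟨W, hW, hxW, hWU, σ, hσ, hσW⟩ := hφ.smooth_symm x (hφt ▸ hOU hxO)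
  obtain ⟨W', hW', hyW, hWU', τ, hτ, hτW⟩ := hφ.smooth_symm y (hφt ▸ hOU hy)
  -- after dropping finitely many terms, the sources and targets lie where the sections live
  obtain ⟨N, hN⟩ := eventually_atTop.1
    ((hs.eventually (hW.mem_nhds hxW)).and (ht.eventually (hW'.mem_nhds hyW)))
  suffices H : ∃ (a : A) (k : ℕ → ℕ), StrictMono k ∧
      Tendsto (fun n => g (k n + N)) atTop (𝓝 a) by
    obtain ⟨a, k, hk, ha⟩ := H
    exact ⟨a, fun n => k n + N, hk.add_const N, ha⟩
  have hgW : ∀ n, G.src (g (n + N)) ∈ W := fun n => (hN _ (by omega)).1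
  have hgW' : ∀ n, G.tgt (g (n + N)) ∈ W' := fun n => (hN _ (by omega)).2
  replace hs := (tendsto_add_atTop_iff_nat N).2 hs
  replace ht := (tendsto_add_atTop_iff_nat N).2 ht
  clear hN
  generalize hg' : (fun n => g (n + N)) = f
  have hf : ∀ n, g (n + N) = f n := fun n => congrFun hg' n
  simp only [hf] at *
  clear hf hg' g
  have hfψ : ∀ n, f n ∈ ψ.target := fun n =>
    hψt ▸ ⟨hφt ▸ hWU (hgW n), hφt ▸ hWU' (hgW' n)⟩
  have hbψ : ∀ n, ψ.symm (f n) ∈ ψ.source := fun n => ψ.map_target (hfψ n)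
  have hb := hbψ
  simp only [hψs] at hb
  -- the arrow of the linearization that corresponds to `f n`, with its source and target
  have hb2 : ∀ n, (ψ.symm (f n)).2 = G.baseQuot (σ (G.src (f n))) := fun n => by
    rw [(hσW _ (hgW n)).2]
    have := hsrc _ (hbψ n)
    rw [ψ.right_inv (hfψ n)] at this
    rw [this, φ.left_inv (hφs ▸ (hb n).2.1)]
    rfl
  have hbt : ∀ n, G.linTgt (ψ.symm (f n)) = G.baseQuot (τ (G.tgt (f n))) := fun n => by
    rw [(hτW _ (hgW' n)).2]
    have := htgt _ (hbψ n)
    rw [ψ.right_inv (hfψ n)] at this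
    rw [this, φ.left_inv (hφs ▸ (hb n).2.2)]
  set h : ℕ → A := fun n => (ψ.symm (f n)).1
  set p : ℕ → A := fun n => (τ (G.tgt (f n))).1
  set q : ℕ → A := fun n => (σ (G.src (f n))).1
  have hqx : ∀ n, G.src (q n) = x := fun n => (hσW _ (hgW n)).1.1
  have hpx : ∀ n, G.src (p n) = x := fun n => (hτW _ (hgW' n)).1.1
  have hhq : ∀ n, G.src (h n) = G.tgt (q n) := fun n => by
    rw [show G.tgt (q n) = _ from (hσW _ (hgW n)).1.2]
    exact (hb n).1.1.trans (congrArg Sigma.fst (hb2 n))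
  have hhp : ∀ n, G.tgt (h n) = G.tgt (p n) := fun n => by
    rw [show G.tgt (p n) = _ from (hτW _ (hgW' n)).1.2]
    exact congrArg Sigma.fst (hbt n)
  have hσlim : Tendsto (fun n => σ (G.src (f n))) atTop (𝓝 (σ x)) :=
    ((hσ.continuousOn.continuousAt (hW.mem_nhds hxW)).tendsto).comp hs
  have hτlim : Tendsto (fun n => τ (G.tgt (f n))) atTop (𝓝 (τ y)) :=
    ((hτ.continuousOn.continuousAt (hW'.mem_nhds hyW)).tendsto).comp ht
  have hplim : Tendsto p atTop (𝓝 (τ y).1) := (continuous_fst.tendsto _).comp hτlim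
  have hσx : G.baseQuot (σ x) = G.normalClass x 0 := by rw [(hσW x hxW).2, hφsymm0 x hxO]
  have hτy : G.baseQuot (τ y) = G.normalClass y 0 := by rw [(hτW y hyW).2, hφsymm0 y hy]
  have hqlim1 : G.src (σ x).1 = x := (hσW x hxW).1.1
  have hqlim2 : G.tgt (σ x).1 = x := (hσW x hxW).1.2.trans (congrArg Sigma.fst hσx)
  have hplim1 : G.src (τ y).1 = x := (hτW y hyW).1.1
  have hplim2 : G.tgt (τ y).1 = y := (hτW y hyW).1.2.trans (congrArg Sigma.fst hτy)
  -- move the arrows into the isotropy group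
  set κ : ℕ → A := fun n => G.mul (G.inv (p n)) (G.mul (h n) (q n)) with hκ
  have hpc : ∀ n, G.tgt (p n) = G.tgt (G.mul (h n) (q n)) := fun n => by
    rw [G.tgt_mul _ _ (hhq n), hhp]
  have hpc' : ∀ n, G.src (G.inv (p n)) = G.tgt (G.mul (h n) (q n)) := fun n => by
    rw [G.src_inv, hpc]
  have hκK : ∀ n, κ n ∈ G.isotropy x := fun n =>
    ⟨by rw [hκ, G.src_mul _ _ (hpc' n), G.src_mul _ _ (hhq n), hqx],
      by rw [hκ, G.tgt_mul _ _ (hpc' n), G.tgt_inv, hpx]⟩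
  obtain ⟨c, hc, k, hk, hkc⟩ := hK.isSeqCompact hκK
  have hpκ : ∀ n, G.mul (p n) (κ n) = G.mul (h n) (q n) := fun n =>
    G.mul_inv_mul_cancel (hpc n)
  have hpκlim : Tendsto (fun n => G.mul (p (k n)) (κ (k n))) atTop (𝓝 (G.mul (τ y).1 c)) :=
    G.tendsto_mul (hplim.comp hk.tendsto_atTop) hkc
      (fun n => by rw [hpx, (hκK _).2]) (by rw [hplim1, hc.2])
  have hpc1 : G.src (G.mul (τ y).1 c) = x := by rw [G.src_mul _ _ (by rw [hplim1, hc.2]), hc.1]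
  have hpc2 : G.tgt (G.mul (τ y).1 c) = y := by rw [G.tgt_mul _ _ (by rw [hplim1, hc.2]), hplim2]
  have hcomp : G.src (G.mul (τ y).1 c) = G.tgt (G.inv (σ x).1) := by
    rw [hpc1, G.tgt_inv, hqlim1]
  -- the limit arrow and the corresponding arrow of the linearization
  set l : A := G.mul (G.mul (τ y).1 c) (G.inv (σ x).1) with hl
  have hl1 : G.src l = x := by rw [hl, G.src_mul _ _ hcomp, G.src_inv, hqlim2]
  have hl2 : G.tgt l = y := by rw [hl, G.tgt_mul _ _ hcomp, hpc2]
  -- This avoids computing `l · 0`: the preimage of `l` under `ψ` has zero normal part, and `ψ` is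
  -- the identity on `G_𝒪`.
  have hlψ : (l, G.normalClass x 0) ∈ ψ.source := by
    have hlt : l ∈ ψ.target := by
      rw [hψt]
      exact ⟨hl1.symm ▸ hOU hxO, hl2.symm ▸ hOU hy⟩
    have hmem := ψ.map_target hlt
    have hmem' := hmem
    rw [hψs] at hmem'
    have e2 : (ψ.symm l).2 = G.normalClass x 0 := by
      have := hsrc _ hmem
      rw [ψ.right_inv hlt, hl1] at this
      rw [← hφsymm0 x hxO, this, φ.left_inv (hφs ▸ hmem'.2.1)]
      rfl
    have e1 : G.src (ψ.symm l).1 = x := hmem'.1.1.trans (congrArg Sigma.fst e2)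
    have e3 := hψ0 (ψ.symm l).1 (e1.symm ▸ hxO)
    rw [e1, ← e2, Prod.mk.eta, ψ.right_inv hlt] at e3
    rw [e3, ← e2]
    exact hmem
  -- `NormalVector` carries no topology here, so convergence is checked on lifts to `arrowFrame`,
  -- where `ψ ∘ arrowQuot` is continuous.
  let z : ℕ → A × (A × TangentBundle 𝓘(ℝ, E) M) := fun n =>
    (G.mul (p n) (κ n), σ (G.src (f n)))
  have hzq : ∀ n, G.arrowQuot (z n) = ψ.symm (f n) := fun n => by
    refine Prod.ext ?_ (hb2 n).symm
    change G.mul (G.mul (p n) (κ n)) (G.inv (q n)) = h n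
    rw [hpκ, G.mul_mul_inv_cancel (hhq n)]
  have hz : ∀ n, z n ∈ G.arrowFrame x ∩ G.arrowQuot ⁻¹' ψ.source := fun n =>
    ⟨⟨by change G.src (G.mul (p n) (κ n)) = x; rw [hpκ, G.src_mul _ _ (hhq n), hqx],
      (hσW _ (hgW n)).1⟩, by rw [mem_preimage, hzq]; exact hbψ n⟩
  have hzl : (G.mul (τ y).1 c, σ x) ∈ G.arrowFrame x ∩ G.arrowQuot ⁻¹' ψ.source := by
    refine ⟨⟨hpc1, (hσW x hxW).1⟩, ?_⟩
    change (l, G.baseQuot (σ x)) ∈ ψ.source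
    rwa [hσx]
  have hzlim : Tendsto (fun n => z (k n)) atTop (𝓝[G.arrowFrame x ∩ G.arrowQuot ⁻¹' ψ.source]
      (G.mul (τ y).1 c, σ x)) :=
    tendsto_nhdsWithin_iff.2
      ⟨hpκlim.prodMk_nhds (hσlim.comp hk.tendsto_atTop), Eventually.of_forall fun n => hz _⟩
  refine ⟨_, k, hk, ((hψ.smooth.continuousOn _ hzl).tendsto.comp hzlim).congr fun n => ?_⟩
  change ψ (G.arrowQuot (z (k n))) = f (k n)
  rw [hzq, ψ.right_inv (hfψ _)]

theorem IsLinearizableAt.isProperAt [T2Space M] [FirstCountableTopology A]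
    {G : LieGroupoid E F M A} {x : M} (hG : G.IsLinearizableAt x)
    (hK : IsCompact (G.isotropy x)) : G.IsProperAt x := fun _ hg =>
  hG.exists_tendsto_subseq hK (G.mem_orbit_self x)
    ((continuous_fst.tendsto (x, x)).comp hg) ((continuous_snd.tendsto (x, x)).comp hg)

/-- If the targets of a sequence of arrows whose sources converge to `x` accumulate at a point of
the orbit of `x`, then the sequence has a convergent subsequence. -/
theorem IsLinearizableAt.exists_tendsto_subseq_of_mapClusterPt [T2Space M]
    [FirstCountableTopology M] [FirstCountableTopology A]
    {G : LieGroupoid E F M A} {x : M} (hG : G.IsLinearizableAt x)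
    (hK : IsCompact (G.isotropy x)) {y : M} (hy : y ∈ G.orbit x) {g : ℕ → A}
    (hs : Tendsto (fun n => G.src (g n)) atTop (𝓝 x))
    (ht : MapClusterPt y atTop fun n => G.tgt (g n)) :
    ∃ (a : A) (k : ℕ → ℕ), StrictMono k ∧ Tendsto (fun n => g (k n)) atTop (𝓝 a) := by
  obtain ⟨k, hk, hkt⟩ := ht.tendsto_subseq
  obtain ⟨a, k', hk', ha⟩ := hG.exists_tendsto_subseq hK hy (hs.comp hk.tendsto_atTop) hkt
  exact ⟨a, k ∘ k', hk.comp hk', ha⟩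

theorem IsLinearizableAt.isSProperAt_of_not_isOpen_orbit [TopologicalSpace.MetrizableSpace M]
    [TopologicalSpace.MetrizableSpace A] {G : LieGroupoid E F M A} {x : M}
    (hG : G.IsLinearizableAt x) (hK : IsCompact (G.isotropy x)) (hst : G.IsStableOrbit x)
    (hO : ¬ IsOpen (G.orbit x)) : G.IsSProperAt x := by
  let _ := TopologicalSpace.metrizableSpaceMetric A
  let _ := TopologicalSpace.metrizableSpaceMetric M
  intro g hg
  have hdense : Dense (G.src ⁻¹' (G.orbit x)ᶜ) :=
    (interior_eq_empty_iff_dense_compl.1 (G.interior_orbit_eq_empty hO)).preimage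
      G.src_submersion.isOpenMap
  -- perturb the arrows off the orbit
  have hpert : ∀ n : ℕ, ∃ a, G.src a ∉ G.orbit x ∧ dist a (g n) < 1 / ((n : ℝ) + 1) ∧
      dist (G.src a) (G.src (g n)) < 1 / ((n : ℝ) + 1) := fun n => by
    have hpos : 0 < 1 / ((n : ℝ) + 1) := by positivity
    -- Both distances are bounded because `src` need not be uniformly continuous.
    obtain ⟨a, ha, ha'⟩ := hdense.inter_open_nonempty
      (Metric.ball (g n) (1 / ((n : ℝ) + 1)) ∩
        G.src ⁻¹' Metric.ball (G.src (g n)) (1 / ((n : ℝ) + 1)))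
      (Metric.isOpen_ball.inter (Metric.isOpen_ball.preimage G.continuous_src))
      ⟨g n, Metric.mem_ball_self hpos, Metric.mem_ball_self hpos⟩
    exact ⟨a, ha', ha.1, ha.2⟩
  choose f hfO hfg hfs using hpert
  have hlim0 := tendsto_one_div_add_atTop_nhds_zero_nat (𝕜 := ℝ)
  have hdist : Tendsto (fun n => dist (f n) (g n)) atTop (𝓝 0) :=
    squeeze_zero (fun _ => dist_nonneg) (fun n => (hfg n).le) hlim0
  have hf : Tendsto (fun n => G.src (f n)) atTop (𝓝 x) :=
    (tendsto_iff_of_dist (squeeze_zero (fun _ => dist_nonneg) (fun n => (hfs n).le) hlim0)).2 hg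
  obtain ⟨y, hy, hcl⟩ := hst.exists_mapClusterPt hf hfO
  obtain ⟨a, k, hk, ha⟩ := hG.exists_tendsto_subseq_of_mapClusterPt hK hy hf hcl
  exact ⟨a, k, hk, (tendsto_iff_of_dist (hdist.comp hk.tendsto_atTop)).1 ha⟩

theorem IsLinearizableAt.isSProperAt_of_isCompact_orbit [TopologicalSpace.MetrizableSpace M]
    [FirstCountableTopology A] {G : LieGroupoid E F M A} {x : M}
    (hG : G.IsLinearizableAt x) (hK : IsCompact (G.isotropy x)) (hst : G.IsStableOrbit x)
    (hO : IsCompact (G.orbit x)) : G.IsSProperAt x := by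
  intro g hg
  -- Infinitely many arrows inside the orbit have targets in a compact set; otherwise almost all lie
  -- off it and stability applies.
  by_cases hev : ∃ᶠ n in atTop, G.src (g n) ∈ G.orbit x
  · obtain ⟨k, hk, hkO⟩ := extraction_of_frequently_atTop hev
    obtain ⟨y, hy, k', hk', hy'⟩ :=
      hO.isSeqCompact fun n => G.tgt_mem_orbit_of_src_mem (hkO n)
    obtain ⟨a, m, hm, ha⟩ := hG.exists_tendsto_subseq hK hy
      (hg.comp (hk.comp hk').tendsto_atTop) hy'
    exact ⟨a, k ∘ k' ∘ m, hk.comp (hk'.comp hm), ha⟩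
  · obtain ⟨k, hk, hkO⟩ := extraction_of_eventually_atTop (not_frequently.1 hev)
    have hgk := hg.comp hk.tendsto_atTop
    obtain ⟨y, hy, hcl⟩ := hst.exists_mapClusterPt (g := g ∘ k) hgk hkO
    obtain ⟨a, m, hm, ha⟩ := hG.exists_tendsto_subseq_of_mapClusterPt hK hy hgk hcl
    exact ⟨a, k ∘ m, hk.comp hm, ha⟩

end Linearizable

end LieGroupoid

theorem mainTheorem6 {E F M A : Type*}
    [NormedAddCommGroup E] [NormedSpace ℝ E] [FiniteDimensional ℝ E]
    [NormedAddCommGroup F] [NormedSpace ℝ F] [FiniteDimensional ℝ F]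
    [TopologicalSpace M] [T2Space M] [SecondCountableTopology M]
    [ChartedSpace E M] [IsManifold 𝓘(ℝ, E) ∞ M]
    [TopologicalSpace A] [T2Space A] [SecondCountableTopology A]
    [ChartedSpace F A] [IsManifold 𝓘(ℝ, F) ∞ A]
    (G : LieGroupoid E F M A) (x : M) (hG : G.IsLinearizableAt x) :
    (G.IsProperAt x ↔ IsCompact (G.isotropy x)) ∧
    (G.IsSProperAt x → IsCompact (G.isotropy x) ∧ G.IsStableOrbit x) ∧
    (¬ IsOpen (G.orbit x) ∨ IsCompact (G.orbit x) →
      (IsCompact (G.isotropy x) ∧ G.IsStableOrbit x → G.IsSProperAt x)) := by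
  have := Manifold.locallyCompact_of_finiteDimensional (M := M) 𝓘(ℝ, E)
  have := Manifold.locallyCompact_of_finiteDimensional (M := A) 𝓘(ℝ, F)
  have := Manifold.metrizableSpace 𝓘(ℝ, E) M
  have := Manifold.metrizableSpace 𝓘(ℝ, F) A
  refine ⟨⟨fun h => h.isCompact_isotropy, fun h => hG.isProperAt h⟩,
    fun h => ⟨h.isProperAt.isCompact_isotropy, h.isStableOrbit⟩, ?_⟩
  rintro (hO | hO) ⟨hK, hst⟩
  · exact hG.isSProperAt_of_not_isOpen_orbit hK hst hO
  · exact hG.isSProperAt_of_isCompact_orbit hK hst hO
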